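/- Let $\kappa := \sqrt{\pi/2}$, let $\mathrm{sign}_{\mathbb C}(\lambda) := \lambda/|\lambda|$ for $\lambda \in \mathbb C\setminus\{0\}$ and $\mathrm{sign}_{\mathbb C}(0) := 0$ (applied componentwise to vectors), and let $\langle x, y\rangle := \sum_i x_i^* y_i$ on $\mathbb C^d$. For a bounded set $T \subset \mathbb R^n$ let $w(T) := \mathbb E \sup_{u \in T} \langle g, u\rangle$, with $g$ a standard Gaussian vector of $\mathbb R^n$, be its Gaussian mean width (with $w(\emptyset) := 0$). Let $\mathcal N_{\mathbb C}^{m\times n}(0,2)$ be the law of an $m \times n$ random matrix whose entries are independent and have independent standard normal $\mathcal N(0,1)$ real and imaginary parts. A symmetric cone is a set $\mathcal K \subset \mathbb R^n$ (not necessarily convex) with $-\mathcal K = \mathcal K$ and $\lambda \mathcal K \subset \mathcal K$ for all $\lambda > 0$. There exist absolute constants $C, c > 0$ such that the following holds for all integers $m, n \geq 1$. Given a symmetric cone $\mathcal K \subset \mathbb R^n$, $\delta > 0$, and a fixed $z \in \mathbb S^{n-1} = \{v \in \mathbb R^n : \|v\|_2 = 1\}$, if $$ m \geq C \delta^{-2}\,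 w^2(\mathcal K \cap \mathbb S^{n-1}), $$ then, with probability exceeding $1 - C\exp(-c\delta^2 m)$, the random matrix $\Phi \sim \mathcal N_{\mathbb C}^{m\times n}(0,2)$ satisfies $$ \Big| \tfrac{1}{\kappa m} \langle \mathrm{sign}_{\mathbb C}(\Phi z), \Phi u\rangle - \langle z, u\rangle \Big| \leq \delta \|u\|_2 \quad \text{for all } u \in \mathcal K. $$ -/

import Mathlib

open MeasureTheory ProbabilityTheory
open scoped NNReal Matrix Pointwise

noncomputable section

/-- A symmetric cone `K` of `ℝⁿ`: `-K = K`, and `t K ⊆ K` for all `t > 0`. No convexity is assumed,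
so that unions of subspaces and sets of sparse vectors are included. -/
def IsSymmetricCone {n : ℕ} (K : Set (EuclideanSpace ℝ (Fin n))) : Prop :=
  -K = K ∧ ∀ t : ℝ, 0 < t → t • K ⊆ K

/-- The Gaussian mean width `w(T) = 𝔼 sup_{u ∈ T} ⟨g, u⟩` of a bounded set `T ⊆ ℝⁿ`, where `g` is a
standard Gaussian vector of `ℝⁿ` (with `w(∅) = 0`). -/
def gaussianMeanWidth {n : ℕ} (T : Set (EuclideanSpace ℝ (Fin n))) : ℝ :=
  ∫ g, (⨆ u : T, inner ℝ g (u : EuclideanSpace ℝ (Fin n)))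
    ∂(stdGaussian (EuclideanSpace ℝ (Fin n)))

/-- The complex sign `z / |z|` for `z ≠ 0`, and `0` for `z = 0`. -/
def signC (z : ℂ) : ℂ := if z = 0 then 0 else z / (‖z‖ : ℂ)

/-- The law on `ℂ` with independent real and imaginary parts of laws `𝒩(Re μ, v/2)` and
`𝒩(Im μ, v/2)`. -/
def complexGaussian (μ : ℂ) (v : ℝ≥0) : Measure ℂ :=
  ((gaussianReal μ.re (v / 2)).prod (gaussianReal μ.im (v / 2))).map (fun p => ⟨p.1, p.2⟩)

/-- The law of an `m × n` random matrix, given as the array of its entries, with i.i.d. entries of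
law `complexGaussian μ v`. -/
def complexGaussianMatrix (m n : ℕ) (μ : ℂ) (v : ℝ≥0) : Measure (Fin m → Fin n → ℂ) :=
  Measure.pi fun _ => Measure.pi fun _ => complexGaussian μ v

/-- The product `Φ u ∈ ℂᵐ` of a complex matrix and a real vector. -/
def mulRealVec {m n : ℕ} (Φ : Matrix (Fin m) (Fin n) ℂ) (u : EuclideanSpace ℝ (Fin n)) :
    Fin m → ℂ :=
  Φ *ᵥ fun j => (u j : ℂ)

/-- The scalar product `⟨x, y⟩ = ∑ i, conj (x i) * y i` on `ℂᵐ`. -/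
def cinner {m : ℕ} (x y : Fin m → ℂ) : ℂ := star x ⬝ᵥ y

/-- The constant `κ = √(π / 2)`. -/
def kappa : ℝ := Real.sqrt (Real.pi / 2)

end

/-! Split `u = ⟨z, u⟩ z + p` with `p ⟂ z`. Since `conj (sign w) * w = |w|`, the first component
contributes `⟨z, u⟩ ∑ᵢ |(Φ z)ᵢ|`, whose mean is `κ m ⟨z, u⟩`; this explains the normalisation. The
real and imaginary parts of the rest are inner products of `u` with `P Y_ζ` for `ζ = 1, i`, where
`Y_ζ` is `signCorrelation ζ z Φ` and `P` projects onto the complement of `z` (`cinner_sign_eq`).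

The key fact is that `P Y_ζ` is exactly Gaussian, with the law of `√m P g`
(`map_starProjection_signCorrelation`): given `Φ z`, the entries of `Φ p` are still independent
complex Gaussians, and multiplying them by unimodular signs does not change their law. A bound
uniform over the cone thus becomes a bound on the supremum of a Gaussian process, whose mean is at
most `√m (w + 4)`.

Fluctuations of both parts come from a single concentration inequality,
`hasSubgaussianMGF_supInner`, because the modulus on `ℂ` is the support function of the unit disc.
It is a discrete form of the Maurey–Pisier rotation argument, which needs no derivative of the
supremum and gives the variance proxy `π² / 4`. -/

/-! ### Support functions of bounded families. -/

section SupInner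

variable {E ι : Type*} [NormedAddCommGroup E] [InnerProductSpace ℝ E]

/-- The support function `x ↦ sup i, ⟨x, f i⟩` of a family of vectors. -/
noncomputable def supInner (f : ι → E) (x : E) : ℝ := ⨆ i, inner ℝ x (f i)

variable {f : ι → E}

lemma inner_le_norm_of_norm_le_one (hf : ∀ i, ‖f i‖ ≤ 1) (x : E) (i : ι) :
    inner ℝ x (f i) ≤ ‖x‖ :=
  (real_inner_le_norm x (f i)).trans (mul_le_of_le_one_right (norm_nonneg x) (hf i))

lemma bddAbove_range_inner (hf : ∀ i, ‖f i‖ ≤ 1) (x : E) :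
    BddAbove (Set.range fun i => inner ℝ x (f i)) :=
  ⟨‖x‖, by rintro _ ⟨i, rfl⟩; exact inner_le_norm_of_norm_le_one hf x i⟩

lemma inner_le_supInner (hf : ∀ i, ‖f i‖ ≤ 1) (x : E) (i : ι) :
    inner ℝ x (f i) ≤ supInner f x :=
  le_ciSup (bddAbove_range_inner hf x) i

lemma supInner_smul {r : ℝ} (hr : 0 ≤ r) (x : E) : supInner f (r • x) = r * supInner f x := by
  simp only [supInner, real_inner_smul_left, Real.mul_iSup_of_nonneg hr]

variable [Nonempty ι]

lemma supInner_le_norm (hf : ∀ i, ‖f i‖ ≤ 1) (x : E) : supInner f x ≤ ‖x‖ :=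
  ciSup_le (inner_le_norm_of_norm_le_one hf x)

lemma supInner_sub_le (hf : ∀ i, ‖f i‖ ≤ 1) (x y : E) :
    supInner f x - supInner f y ≤ ‖x - y‖ := by
  rw [sub_le_iff_le_add]
  refine ciSup_le fun i => ?_
  have h1 := inner_le_norm_of_norm_le_one hf (x - y) i
  have h2 := inner_le_supInner hf y i
  rw [inner_sub_left] at h1
  linarith

lemma lipschitzWith_supInner (hf : ∀ i, ‖f i‖ ≤ 1) : LipschitzWith 1 (supInner f) :=
  LipschitzWith.of_le_add fun x y => by
    have := supInner_sub_le hf x y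
    rw [dist_eq_norm]
    linarith

lemma continuous_supInner (hf : ∀ i, ‖f i‖ ≤ 1) : Continuous (supInner f) :=
  (lipschitzWith_supInner hf).continuous

lemma abs_supInner_le_norm (hf : ∀ i, ‖f i‖ ≤ 1) (x : E) : |supInner f x| ≤ ‖x‖ := by
  have h0 : supInner f 0 = 0 := by simp [supInner]
  have h1 := supInner_sub_le hf x 0
  have h2 := supInner_sub_le hf 0 x
  rw [h0] at h1 h2
  simp only [sub_zero, zero_sub, norm_neg] at h1 h2
  exact abs_le.2 ⟨by linarith, h1⟩

end SupInner

/-! ### Gaussian concentration of support functions by rotation. -/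

section GaussianConcentration

variable {E ι : Type*} [NormedAddCommGroup E] [InnerProductSpace ℝ E] [FiniteDimensional ℝ E]
  [MeasurableSpace E] [BorelSpace E]

lemma integrable_exp_mul_norm_stdGaussian (a : ℝ) :
    Integrable (fun x : E => Real.exp (a * ‖x‖)) (stdGaussian E) := by
  obtain ⟨C, hC, hint⟩ := IsGaussian.exists_integrable_exp_sq (stdGaussian E)
  refine (hint.const_mul (Real.exp (a ^ 2 / (4 * C)))).mono' (by fun_prop) (ae_of_all _ fun x => ?_)
  rw [Real.norm_eq_abs, Real.abs_exp, ← Real.exp_add, Real.exp_le_exp]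
  have : a ^ 2 / (4 * C) + C * ‖x‖ ^ 2 - a * ‖x‖ = (a - 2 * C * ‖x‖) ^ 2 / (4 * C) := by
    field_simp
    ring
  have h2 : 0 ≤ (a - 2 * C * ‖x‖) ^ 2 / (4 * C) := by positivity
  linarith

lemma integrable_exp_prod_stdGaussian {g : E × E → ℝ} (hg : Continuous g) (a : ℝ)
    (h : ∀ p, g p ≤ a * ‖p.1‖ + a * ‖p.2‖) :
    Integrable (fun p => Real.exp (g p)) ((stdGaussian E).prod (stdGaussian E)) := by
  refine ((integrable_exp_mul_norm_stdGaussian (E := E) a).mul_prod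
    (integrable_exp_mul_norm_stdGaussian (E := E) a)).mono' (by fun_prop)
    (ae_of_all _ fun p => ?_)
  rw [Real.norm_eq_abs, Real.abs_exp, ← Real.exp_add, Real.exp_le_exp]
  exact h p

lemma integral_exp_inner_stdGaussian (v : E) :
    ∫ x, Real.exp (inner ℝ x v) ∂(stdGaussian E) = Real.exp (‖v‖ ^ 2 / 2) := by
  have h := mgf_gaussianReal (IsGaussian.map_eq_gaussianReal (μ := stdGaussian E) (innerSL ℝ v)) 1
  rw [integral_strongDual_stdGaussian, variance_dual_stdGaussian] at h
  simp only [mgf, innerSL_apply_apply, one_mul, innerSL_apply_norm, zero_add, one_pow,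
    mul_one] at h
  rw [Real.coe_toNNReal _ (by positivity)] at h
  simpa [real_inner_comm] using h

lemma integrable_exp_inner_stdGaussian (v : E) :
    Integrable (fun x => Real.exp (inner ℝ x v)) (stdGaussian E) := by
  refine (integrable_exp_mul_norm_stdGaussian ‖v‖).mono' (by fun_prop) (ae_of_all _ fun x => ?_)
  rw [Real.norm_eq_abs, Real.abs_exp, Real.exp_le_exp, mul_comm]
  exact real_inner_le_norm x v

lemma integral_rotation_stdGaussian {g : E × E → ℝ} (hg : Continuous g) (θ : ℝ) :
    ∫ p, g (ContinuousLinearMap.rotation θ p) ∂((stdGaussian E).prod (stdGaussian E)) =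
      ∫ p, g p ∂((stdGaussian E).prod (stdGaussian E)) := by
  conv_rhs => rw [← IsGaussian.map_rotation_eq_self (μ := stdGaussian E) (by simp) θ]
  rw [integral_map (by fun_prop) hg.aestronglyMeasurable]

variable [Nonempty ι] {f : ι → E}

/-- An index nearly optimal at `x` does not depend on `y`. Testing the perturbed supremum at that
index leaves a linear functional of `y`, whose exponential moment is explicit. -/
lemma integral_exp_supInner_sub_le (hf : ∀ i, ‖f i‖ ≤ 1) {a c s : ℝ} (ha : 0 ≤ a) (hc : c ≤ 1)
    (x : E) :
    ∫ y, Real.exp (a * (supInner f x - supInner f (c • x + s • y))) ∂(stdGaussian E) ≤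
      Real.exp (a * (1 - c) * ‖x‖ + (a * s) ^ 2 / 2) := by
  have key : ∀ η : ℝ, 0 < η →
      ∫ y, Real.exp (a * (supInner f x - supInner f (c • x + s • y))) ∂(stdGaussian E) ≤
      Real.exp (a * η + (a * (1 - c) * ‖x‖ + (a * s) ^ 2 / 2)) := by
    intro η hη
    -- The supremum need not be attained, hence the slack `η`, sent to `0` at the end.
    obtain ⟨i, hi⟩ := exists_lt_of_lt_ciSup (show supInner f x - η < supInner f x by linarith)
    have hpt : ∀ y, Real.exp (a * (supInner f x - supInner f (c • x + s • y))) ≤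
        Real.exp (a * η + a * (1 - c) * ‖x‖) * Real.exp (inner ℝ y (-(a * s) • f i)) := by
      intro y
      rw [← Real.exp_add, Real.exp_le_exp, real_inner_smul_right]
      have h1 := inner_le_supInner hf (c • x + s • y) i
      rw [inner_add_left, real_inner_smul_left, real_inner_smul_left] at h1
      have h2 : (1 - c) * inner ℝ x (f i) ≤ (1 - c) * ‖x‖ :=
        mul_le_mul_of_nonneg_left (inner_le_norm_of_norm_le_one hf x i) (by linarith)
      have h3 : supInner f x - supInner f (c • x + s • y) ≤
          η + (1 - c) * ‖x‖ - s * inner ℝ y (f i) := by linarith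
      linarith [mul_le_mul_of_nonneg_left h3 ha]
    have hint := (integrable_exp_inner_stdGaussian (-(a * s) • f i)).const_mul
      (Real.exp (a * η + a * (1 - c) * ‖x‖))
    refine (integral_mono_of_nonneg (ae_of_all _ fun y => (Real.exp_pos _).le) hint
      (ae_of_all _ hpt)).trans ?_
    rw [integral_const_mul, integral_exp_inner_stdGaussian, ← Real.exp_add, Real.exp_le_exp,
      norm_smul, mul_pow, norm_neg, Real.norm_eq_abs, sq_abs]
    have : ‖f i‖ ^ 2 ≤ 1 := pow_le_one₀ (norm_nonneg _) (hf i)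
    nlinarith [mul_le_mul_of_nonneg_left this (sq_nonneg (a * s))]
  have hlim : Filter.Tendsto
      (fun η : ℝ => Real.exp (a * η + (a * (1 - c) * ‖x‖ + (a * s) ^ 2 / 2)))
      (nhdsWithin 0 (Set.Ioi 0))
      (nhds (Real.exp (a * 0 + (a * (1 - c) * ‖x‖ + (a * s) ^ 2 / 2)))) :=
    (Continuous.tendsto (by fun_prop) 0).mono_left nhdsWithin_le_nhds
  rw [mul_zero, zero_add] at hlim
  exact ge_of_tendsto hlim (eventually_nhdsWithin_of_forall key)

/-- Rotation invariance exchanges the two endpoints of the increment, so that the positive term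
becomes the one depending on the first variable alone and the near-maximiser bound applies. -/
lemma integral_exp_supInner_rotation_le (hf : ∀ i, ‖f i‖ ≤ 1) {a : ℝ} (ha : 0 ≤ a) (h : ℝ) :
    ∫ p, Real.exp (a * (supInner f (Real.cos h • p.1 + Real.sin h • p.2) - supInner f p.1))
        ∂((stdGaussian E).prod (stdGaussian E)) ≤
      Real.exp ((a * Real.sin h) ^ 2 / 2) *
        ∫ x, Real.exp (a * (1 - Real.cos h) * ‖x‖) ∂(stdGaussian E) := by
  have hF := continuous_supInner hf
  have hrot := integral_rotation_stdGaussian (E := E) (g := fun p => Real.exp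
    (a * (supInner f p.1 - supInner f (Real.cos h • p.1 + (-Real.sin h) • p.2)))) (by fun_prop) h
  have heq : ∀ p : E × E, Real.exp
      (a * (supInner f (Real.cos h • p.1 + Real.sin h • p.2) - supInner f p.1)) =
      (fun p : E × E => Real.exp (a * (supInner f p.1 -
        supInner f (Real.cos h • p.1 + (-Real.sin h) • p.2))))
        (ContinuousLinearMap.rotation h p) := by
    intro p
    simp only [ContinuousLinearMap.rotation_apply]
    congr 4
    have : p.1 = (Real.cos h * Real.cos h + Real.sin h * Real.sin h) • p.1 := by
      rw [← sq, ← sq, Real.cos_sq_add_sin_sq, one_smul]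
    conv_lhs => rw [this]
    module
  simp_rw [heq]
  rw [hrot]
  have hint : Integrable (fun p : E × E => Real.exp (a * (supInner f p.1 -
        supInner f (Real.cos h • p.1 + (-Real.sin h) • p.2))))
        ((stdGaussian E).prod (stdGaussian E)) := by
    refine integrable_exp_prod_stdGaussian (by fun_prop) (2 * a) fun p => ?_
    have h1 := supInner_sub_le hf p.1 (Real.cos h • p.1 + (-Real.sin h) • p.2)
    have h2 : ‖p.1 - (Real.cos h • p.1 + (-Real.sin h) • p.2)‖ ≤ ‖p.1‖ + (‖p.1‖ + ‖p.2‖) := by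
      refine (norm_sub_le _ _).trans (add_le_add_right ((norm_add_le _ _).trans ?_) _)
      rw [norm_smul, norm_smul, norm_neg]
      refine add_le_add (mul_le_of_le_one_left (norm_nonneg _) (Real.abs_cos_le_one h))
        (mul_le_of_le_one_left (norm_nonneg _) (Real.abs_sin_le_one h))
    have h3 : supInner f p.1 - supInner f (Real.cos h • p.1 + (-Real.sin h) • p.2) ≤
        2 * ‖p.1‖ + 2 * ‖p.2‖ := by linarith [norm_nonneg p.2]
    linarith [mul_le_mul_of_nonneg_left h3 ha]
  rw [integral_prod _ hint, ← integral_const_mul]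
  refine integral_mono hint.integral_prod_left
    ((integrable_exp_mul_norm_stdGaussian _).const_mul _) fun x => ?_
  refine (integral_exp_supInner_sub_le hf ha (Real.cos_le_one h) x).trans (le_of_eq ?_)
  simp only [← Real.exp_add, mul_neg, neg_sq]
  rw [add_comm]

/-- The quarter circle from `p.1` to `p.2` is cut into `N` equal arcs. By convexity of `exp` the
total increment is controlled by the average of single increments scaled by `N`, all of which have
the same law by rotation invariance. -/
lemma integral_exp_supInner_sub_le_of_pos (hf : ∀ i, ‖f i‖ ≤ 1) {l : ℝ} (hl : 0 ≤ l) {N : ℕ}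
    (hN : 0 < N) :
    ∫ p, Real.exp (l * (supInner f p.2 - supInner f p.1))
        ∂((stdGaussian E).prod (stdGaussian E)) ≤
      Real.exp (Real.pi ^ 2 / 4 * l ^ 2 / 2) *
        ∫ x, Real.exp (2 * l / N * ‖x‖) ∂(stdGaussian E) := by
  have hF := continuous_supInner hf
  have hN0 : (0 : ℝ) < N := by exact_mod_cast hN
  set h : ℝ := Real.pi / (2 * N) with hh
  set Z : ℕ → E × E → E := fun k p => Real.cos (k * h) • p.1 + Real.sin (k * h) • p.2 with hZ
  set a : ℝ := l * N with ha
  have ha0 : 0 ≤ a := by positivity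
  set B : ℝ := Real.exp (Real.pi ^ 2 / 4 * l ^ 2 / 2) *
        ∫ x, Real.exp (2 * l / N * ‖x‖) ∂(stdGaussian E) with hB
  have hZ0 : ∀ p, Z 0 p = p.1 := fun p => by simp [hZ]
  have hZN : ∀ p, Z N p = p.2 := fun p => by
    have : (N : ℝ) * h = Real.pi / 2 := by rw [hh]; field_simp
    simp [hZ, this]
  have hZs : ∀ k p, Z (k + 1) p = Real.cos h • (ContinuousLinearMap.rotation (k * h) p).1 +
      Real.sin h • (ContinuousLinearMap.rotation (k * h) p).2 := fun k p => by
    simp only [hZ, ContinuousLinearMap.rotation_apply, Nat.cast_add, Nat.cast_one, add_mul,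
      one_mul, Real.cos_add, Real.sin_add]
    module
  have hpt : ∀ p, Real.exp (l * (supInner f p.2 - supInner f p.1)) ≤
      ∑ k ∈ Finset.range N, (1 / (N : ℝ)) *
        Real.exp (a * (supInner f (Z (k + 1) p) - supInner f (Z k p))) := by
    intro p
    have := convexOn_exp.map_sum_le (t := Finset.range N) (w := fun _ => 1 / (N : ℝ))
      (p := fun k => a * (supInner f (Z (k + 1) p) - supInner f (Z k p)))
      (fun _ _ => by positivity) (by simp [hN0.ne']) (fun _ _ => Set.mem_univ _)
    simp only [smul_eq_mul] at this
    refine le_trans (le_of_eq ?_) this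
    rw [← Finset.mul_sum, ← Finset.mul_sum,
      Finset.sum_range_sub (fun k => supInner f (Z k p)), hZ0, hZN, ha]
    congr 1
    field_simp
  have hterm_eq : ∀ k, (fun p => Real.exp (a * (supInner f (Z (k + 1) p) - supInner f (Z k p)))) =
      fun p => (fun q : E × E => Real.exp (a * (supInner f (Real.cos h • q.1 + Real.sin h • q.2) -
        supInner f q.1))) (ContinuousLinearMap.rotation (k * h) p) := fun k => by
    ext p
    simp only [hZs]
    rfl
  have hterm : ∀ k, ∫ p, Real.exp (a * (supInner f (Z (k + 1) p) - supInner f (Z k p)))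
      ∂((stdGaussian E).prod (stdGaussian E)) ≤ B := fun k => by
    rw [hterm_eq, integral_rotation_stdGaussian (E := E) (g := fun q => Real.exp (a *
      (supInner f (Real.cos h • q.1 + Real.sin h • q.2) - supInner f q.1))) (by fun_prop)]
    refine (integral_exp_supInner_rotation_le hf ha0 h).trans ?_
    have hNh : a * h = Real.pi / 2 * l := by rw [ha, hh]; field_simp
    have hh0 : 0 < h := by positivity
    refine mul_le_mul ?_ ?_ (integral_nonneg fun _ => (Real.exp_pos _).le) (Real.exp_pos _).le
    · rw [Real.exp_le_exp]
      have h1 : (a * Real.sin h) ^ 2 ≤ (a * h) ^ 2 := by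
        rw [mul_pow a, mul_pow a]
        exact mul_le_mul_of_nonneg_left (sq_le_sq.2 Real.abs_sin_le_abs) (sq_nonneg a)
      rw [hNh] at h1
      nlinarith
    · refine integral_mono (integrable_exp_mul_norm_stdGaussian _)
        (integrable_exp_mul_norm_stdGaussian _) fun x => ?_
      refine Real.exp_le_exp.2 (mul_le_mul_of_nonneg_right ?_ (norm_nonneg x))
      -- The radial loss is quadratic in the angle, so it is `O(1 / N)` even after scaling by `a = l
      -- * N`; here `h ≤ 2 / N` because `π ≤ 4`.
      have h1 : 1 - Real.cos h ≤ h ^ 2 / 2 := by linarith [Real.one_sub_sq_div_two_le_cos (x := h)]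
      have h2 : h ^ 2 / 2 ≤ 2 / (N : ℝ) ^ 2 := by
        have : h ^ 2 ≤ (2 / (N : ℝ)) ^ 2 := by
          refine pow_le_pow_left₀ hh0.le ?_ 2
          rw [hh, div_le_div_iff₀ (by positivity) hN0]
          nlinarith [Real.pi_le_four]
        rw [div_pow 2] at this
        calc h ^ 2 / 2 ≤ 2 ^ 2 / (N : ℝ) ^ 2 / 2 := by linarith
          _ = 2 / (N : ℝ) ^ 2 := by ring
      calc a * (1 - Real.cos h) ≤ a * (2 / N ^ 2) :=
            mul_le_mul_of_nonneg_left (h1.trans h2) ha0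
        _ = 2 * l / N := by rw [ha]; field_simp
  have hint : ∀ k, Integrable (fun p => Real.exp (a * (supInner f (Z (k + 1) p) -
      supInner f (Z k p)))) ((stdGaussian E).prod (stdGaussian E)) := fun k => by
    have hZn : ∀ k p, ‖Z k p‖ ≤ ‖p.1‖ + ‖p.2‖ := fun k p => by
      refine (norm_add_le _ _).trans ?_
      rw [norm_smul, norm_smul]
      exact add_le_add (mul_le_of_le_one_left (norm_nonneg _) (Real.abs_cos_le_one _))
        (mul_le_of_le_one_left (norm_nonneg _) (Real.abs_sin_le_one _))
    refine integrable_exp_prod_stdGaussian (by fun_prop) (2 * a) fun p => ?_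
    have h1 := (supInner_sub_le hf (Z (k + 1) p) (Z k p)).trans (norm_sub_le _ _)
    have h3 : supInner f (Z (k + 1) p) - supInner f (Z k p) ≤ 2 * ‖p.1‖ + 2 * ‖p.2‖ := by
      linarith [hZn k p, hZn (k + 1) p]
    linarith [mul_le_mul_of_nonneg_left h3 ha0]
  refine (integral_mono_of_nonneg (ae_of_all _ fun p => (Real.exp_pos _).le)
    (integrable_finsetSum _ fun k _ => (hint k).const_mul _) (ae_of_all _ hpt)).trans ?_
  rw [integral_finsetSum _ fun k _ => (hint k).const_mul _]
  simp_rw [integral_const_mul]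
  refine (Finset.sum_le_sum fun k _ =>
    mul_le_mul_of_nonneg_left (hterm k) (by positivity : (0 : ℝ) ≤ 1 / N)).trans_eq ?_
  simp [hN0.ne']

lemma tendsto_integral_exp_div_mul_norm (l : ℝ) :
    Filter.Tendsto (fun N : ℕ => ∫ x : E, Real.exp (2 * l / N * ‖x‖) ∂(stdGaussian E))
      Filter.atTop (nhds 1) := by
  have h1 : (1 : ℝ) = ∫ _x : E, Real.exp 0 ∂(stdGaussian E) := by simp
  rw [h1]
  refine tendsto_integral_filter_of_dominated_convergence
    (fun x => Real.exp (|2 * l| * ‖x‖)) ?_ ?_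
    (integrable_exp_mul_norm_stdGaussian _) (ae_of_all _ fun x => ?_)
  · exact Filter.Eventually.of_forall fun N => by fun_prop
  · filter_upwards [Filter.eventually_ge_atTop 1] with N hN
    refine ae_of_all _ fun x => ?_
    rw [Real.norm_eq_abs, Real.abs_exp, Real.exp_le_exp]
    refine mul_le_mul_of_nonneg_right ((le_abs_self _).trans ?_) (norm_nonneg x)
    rw [abs_div, Nat.abs_cast]
    exact div_le_self (abs_nonneg _) (by exact_mod_cast hN)
  · have : Filter.Tendsto (fun N : ℕ => 2 * l / (N : ℝ) * ‖x‖) Filter.atTop (nhds (0 * ‖x‖)) :=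
      (tendsto_const_div_atTop_nhds_zero_nat (2 * l)).mul_const _
    rw [zero_mul] at this
    exact (Real.continuous_exp.tendsto 0).comp this

lemma integral_exp_supInner_sub_le_exp (hf : ∀ i, ‖f i‖ ≤ 1) {l : ℝ} (hl : 0 ≤ l) :
    ∫ p, Real.exp (l * (supInner f p.2 - supInner f p.1))
        ∂((stdGaussian E).prod (stdGaussian E)) ≤ Real.exp (Real.pi ^ 2 / 4 * l ^ 2 / 2) := by
  have hlim := (tendsto_integral_exp_div_mul_norm (E := E) l).const_mul
    (Real.exp (Real.pi ^ 2 / 4 * l ^ 2 / 2))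
  rw [mul_one] at hlim
  refine ge_of_tendsto hlim ?_
  filter_upwards [Filter.eventually_ge_atTop 1] with N hN
  exact integral_exp_supInner_sub_le_of_pos hf hl hN

lemma integrable_supInner_stdGaussian (hf : ∀ i, ‖f i‖ ≤ 1) :
    Integrable (supInner f) (stdGaussian E) :=
  (IsGaussian.integrable_id (μ := stdGaussian E)).norm.mono'
    (continuous_supInner hf).aestronglyMeasurable (ae_of_all _ (abs_supInner_le_norm hf))

/-- Gaussian concentration for suprema of linear functionals of norm at most one. -/
lemma hasSubgaussianMGF_supInner (hf : ∀ i, ‖f i‖ ≤ 1) :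
    HasSubgaussianMGF (fun x => supInner f x - ∫ y, supInner f y ∂(stdGaussian E))
      (Real.pi ^ 2 / 4).toNNReal (stdGaussian E) := by
  have hF := continuous_supInner hf
  set M : ℝ := ∫ y, supInner f y ∂(stdGaussian E) with hM
  have hint : ∀ t : ℝ, Integrable (fun x => Real.exp (t * (supInner f x - M))) (stdGaussian E) := by
    intro t
    refine ((integrable_exp_mul_norm_stdGaussian |t|).const_mul (Real.exp (-(t * M)))).mono'
      (by fun_prop) (ae_of_all _ fun x => ?_)
    rw [Real.norm_eq_abs, Real.abs_exp, ← Real.exp_add, Real.exp_le_exp]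
    have h1 := le_abs_self (t * supInner f x)
    rw [abs_mul] at h1
    have h2 := mul_le_mul_of_nonneg_left (abs_supInner_le_norm hf x) (abs_nonneg t)
    linarith
  -- Jensen for the centred variable: in the product of moment generating functions at `l` and `-l`,
  -- either factor can be dropped, which undoes the symmetrisation.
  have hone : ∀ t : ℝ, 1 ≤ mgf (fun x => supInner f x - M) (stdGaussian E) t := by
    intro t
    have hiF := integrable_supInner_stdGaussian hf
    have hiM : Integrable (fun x => supInner f x - M) (stdGaussian E) :=
      hiF.sub (integrable_const _)
    have h1 : ∫ x, (1 + t * (supInner f x - M)) ∂(stdGaussian E) = 1 := by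
      rw [integral_add (integrable_const _) (hiM.const_mul _),
        integral_const_mul, integral_sub hiF (integrable_const _)]
      simp [hM]
    rw [← h1]
    refine integral_mono ((integrable_const _).add (hiM.const_mul _)) (hint t) fun x => ?_
    have := Real.add_one_le_exp (t * (supInner f x - M))
    simp only
    linarith
  have hprod : ∀ l : ℝ, 0 ≤ l → mgf (fun x => supInner f x - M) (stdGaussian E) (-l) *
      mgf (fun x => supInner f x - M) (stdGaussian E) l ≤
        Real.exp (Real.pi ^ 2 / 4 * l ^ 2 / 2) := by
    intro l hl
    refine le_trans (le_of_eq ?_) (integral_exp_supInner_sub_le_exp hf hl)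
    rw [mgf, mgf, ← integral_prod_mul]
    refine integral_congr_ae (ae_of_all _ fun p => ?_)
    simp only [← Real.exp_add]
    congr 1
    ring
  refine ⟨hint, fun t => ?_⟩
  rw [Real.coe_toNNReal _ (by positivity)]
  rcases le_total 0 t with ht | ht
  · exact (le_mul_of_one_le_left (zero_le_one.trans (hone t)) (hone (-t))).trans (hprod t ht)
  · have := hprod (-t) (by linarith)
    rw [neg_neg, neg_sq] at this
    exact (le_mul_of_one_le_right (zero_le_one.trans (hone t)) (hone (-t))).trans this

end GaussianConcentration

/-! ### The complex Gaussian and its mean modulus. -/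

section ComplexGaussian

lemma charFun_complexGaussian_zero_two (t : ℂ) :
    charFun (complexGaussian 0 2) t = Complex.exp (-‖t‖ ^ 2 / 2) := by
  have hm : Measurable fun p : ℝ × ℝ => (⟨p.1, p.2⟩ : ℂ) :=
    Complex.measurableEquivRealProd.symm.measurable
  have h1 := charFun_gaussianReal (μ := 0) (v := 1)
  rw [charFun_apply, complexGaussian, integral_map hm.aemeasurable (by fun_prop)]
  have h2 : ∀ p : ℝ × ℝ, Complex.exp (((inner ℝ (⟨p.1, p.2⟩ : ℂ) t : ℝ) : ℂ) * Complex.I) =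
      Complex.exp (t.re * p.1 * Complex.I) * Complex.exp (t.im * p.2 * Complex.I) := by
    intro p
    rw [← Complex.exp_add, Complex.inner]
    congr 1
    simp
    ring
  simp_rw [h2]
  rw [integral_prod_mul (fun x : ℝ => Complex.exp (t.re * x * Complex.I))
    (fun x : ℝ => Complex.exp (t.im * x * Complex.I))]
  simp only [Complex.zero_re, Complex.zero_im, ← charFun_apply_real]
  rw [div_self two_ne_zero, charFun_gaussianReal, charFun_gaussianReal, ← Complex.exp_add]
  congr 1
  have h3 : (‖t‖ : ℂ) ^ 2 = (t.re : ℂ) ^ 2 + (t.im : ℂ) ^ 2 := by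
    have : ‖t‖ ^ 2 = t.re ^ 2 + t.im ^ 2 := by
      rw [← Complex.normSq_eq_norm_sq, Complex.normSq_apply]; ring
    exact_mod_cast this
  rw [h3]
  push_cast
  ring

instance isProbabilityMeasure_complexGaussian (μ : ℂ) (v : ℝ≥0) :
    IsProbabilityMeasure (complexGaussian μ v) :=
  Measure.isProbabilityMeasure_map
    Complex.measurableEquivRealProd.symm.measurable.aemeasurable

lemma complexGaussian_zero_two : complexGaussian 0 2 = stdGaussian ℂ :=
  Measure.ext_of_charFun (by ext t; rw [charFun_complexGaussian_zero_two, charFun_stdGaussian])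

/-- The density is radial, so the mean reduces to a Gamma integral with value `Γ(3/2)`. This is
where `κ` originates. -/
lemma integral_norm_stdGaussian_complex : ∫ x : ℂ, ‖x‖ ∂(stdGaussian ℂ) = kappa := by
  have hm : Measurable fun p : ℝ × ℝ => (⟨p.1, p.2⟩ : ℂ) :=
    Complex.measurableEquivRealProd.symm.measurable
  rw [← complexGaussian_zero_two, complexGaussian,
    integral_map hm.aemeasurable (by fun_prop)]
  simp only [Complex.zero_re, Complex.zero_im]
  rw [div_self two_ne_zero, gaussianReal_of_var_ne_zero _ one_ne_zero,
    prod_withDensity (by fun_prop) (by fun_prop),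
    integral_withDensity_eq_integral_toReal_smul (by fun_prop)
      (ae_of_all _ fun p => ENNReal.mul_lt_top gaussianPDF_lt_top gaussianPDF_lt_top)]
  have h1 : ∀ p : ℝ × ℝ, (gaussianPDF 0 1 p.1 * gaussianPDF 0 1 p.2).toReal •
      ‖(⟨p.1, p.2⟩ : ℂ)‖ = (fun z : ℂ => (2 * Real.pi)⁻¹ *
        (‖z‖ ^ (1 : ℝ) * Real.exp (-(1 / 2) * ‖z‖ ^ (2 : ℝ))))
          (Complex.measurableEquivRealProd.symm p) := by
    intro p
    have hz : Complex.measurableEquivRealProd.symm p = ⟨p.1, p.2⟩ := rfl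
    have h3 : ‖(⟨p.1, p.2⟩ : ℂ)‖ ^ 2 = p.1 ^ 2 + p.2 ^ 2 := by
      rw [← Complex.normSq_eq_norm_sq, Complex.normSq_apply]; ring
    have h4 : (√(2 * Real.pi))⁻¹ * (√(2 * Real.pi))⁻¹ = (2 * Real.pi)⁻¹ := by
      rw [← mul_inv, Real.mul_self_sqrt (by positivity)]
    rw [ENNReal.toReal_mul, toReal_gaussianPDF, toReal_gaussianPDF, hz]
    simp only [gaussianPDFReal, Real.rpow_one, Real.rpow_two, h3, smul_eq_mul, NNReal.coe_one,
      mul_one, sub_zero]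
    rw [show -(1 / 2 : ℝ) * (p.1 ^ 2 + p.2 ^ 2) = -p.1 ^ 2 / 2 + -p.2 ^ 2 / 2 by ring,
      Real.exp_add, ← h4]
    ring
  simp_rw [h1]
  rw [← Measure.volume_eq_prod,
    (Complex.volume_preserving_equiv_real_prod.symm).integral_comp'
      (g := fun z : ℂ => (2 * Real.pi)⁻¹ *
        (‖z‖ ^ (1 : ℝ) * Real.exp (-(1 / 2) * ‖z‖ ^ (2 : ℝ)))), integral_const_mul,
    Complex.integral_rpow_mul_exp_neg_mul_rpow one_le_two (by norm_num) (by norm_num),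
    show ((1 : ℝ) + 2) / 2 = 1 / 2 + 1 by norm_num, Real.Gamma_add_one (by norm_num),
    Real.Gamma_one_half_eq, show (-((1 : ℝ) + 2) / 2) = -(1 + 1 / 2) by norm_num,
    Real.rpow_neg (by norm_num), Real.rpow_add (by norm_num), ← Real.sqrt_eq_rpow, kappa,
    Real.rpow_one, Real.sqrt_div (by positivity), Real.sqrt_div (by positivity), Real.sqrt_one]
  have h2 : √2 * √2 = 2 := Real.mul_self_sqrt (by norm_num)
  have hs : √(2 : ℝ) ≠ 0 := by positivity
  field_simp
  nlinarith

end ComplexGaussian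

/-! ### Conditioning on a linear image of a Gaussian vector. -/

section Conditioning

variable {V W : Type*} [NormedAddCommGroup V] [InnerProductSpace ℝ V] [FiniteDimensional ℝ V]
  [MeasurableSpace V] [BorelSpace V]

/-- Orthogonal components of a standard Gaussian are independent, so one of them can be resampled.
This replaces conditional distributions below. -/
lemma map_starProjection_add_stdGaussian (S : Submodule ℝ V) :
    ((stdGaussian V).prod (stdGaussian V)).map
      (fun p => S.starProjection p.1 + Sᗮ.starProjection p.2) = stdGaussian V := by
  have hm : Measurable fun p : V × V => S.starProjection p.1 + Sᗮ.starProjection p.2 := by fun_prop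
  have : IsProbabilityMeasure (((stdGaussian V).prod (stdGaussian V)).map
      (fun p => S.starProjection p.1 + Sᗮ.starProjection p.2)) :=
    Measure.isProbabilityMeasure_map hm.aemeasurable
  refine Measure.ext_of_charFun ?_
  ext t
  rw [charFun_apply, integral_map hm.aemeasurable (by fun_prop)]
  simp_rw [inner_add_left, Submodule.inner_starProjection_left_eq_right, Complex.ofReal_add,
    add_mul, Complex.exp_add]
  rw [integral_prod_mul (fun x : V => Complex.exp ((inner ℝ x (S.starProjection t) : ℝ) *
      Complex.I)) (fun x : V => Complex.exp ((inner ℝ x (Sᗮ.starProjection t) : ℝ) * Complex.I)),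
    ← charFun_apply, ← charFun_apply, charFun_stdGaussian, charFun_stdGaussian,
    charFun_stdGaussian, ← Complex.exp_add]
  congr 1
  have h := S.norm_sq_eq_add_norm_sq_starProjection t
  have h' : (‖t‖ : ℂ) ^ 2 = (‖S.starProjection t‖ : ℂ) ^ 2 + (‖Sᗮ.starProjection t‖ : ℂ) ^ 2 := by
    exact_mod_cast h
  rw [h']
  ring

/-- If `d (X v)` always lies in the kernel of `X`, then conditionally on `X v` the variable
`⟨v, d (X v)⟩` is a centered Gaussian of standard deviation `‖d (X v)‖`. -/
lemma integral_cexp_inner_comp_stdGaussian [NormedAddCommGroup W] [NormedSpace ℝ W]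
    [MeasurableSpace W] [BorelSpace W] (X : V →L[ℝ] W) {d : W → V} (hd : Measurable d)
    (hX : ∀ w, X (d w) = 0) {r : ℝ} (hr : ∀ᵐ v ∂(stdGaussian V), ‖d (X v)‖ = r) :
    ∫ v, Complex.exp ((inner ℝ v (d (X v)) : ℝ) * Complex.I) ∂(stdGaussian V) =
      Complex.exp (-r ^ 2 / 2) := by
  -- `X` sees only the `S` component, while `d` takes values in `Sᗮ`. After resampling, `d (X p.1)`
  -- is paired with the independent `p.2`.
  set S : Submodule ℝ V := (LinearMap.ker (X : V →ₗ[ℝ] W))ᗮ with hS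
  have hSo : ∀ v, v ∈ Sᗮ ↔ X v = 0 := fun v => by
    rw [hS, Submodule.orthogonal_orthogonal, LinearMap.mem_ker]
    rfl
  have hmX : Measurable X := X.continuous.measurable
  have hXS : ∀ v, X (S.starProjection v) = X v := by
    intro v
    have h1 := (hSo _).1 (Submodule.sub_starProjection_mem_orthogonal (K := S) v)
    rw [map_sub] at h1
    exact (sub_eq_zero.1 h1).symm
  have hXo : ∀ v, X (Sᗮ.starProjection v) = 0 :=
    fun v => (hSo _).1 (Submodule.starProjection_apply_mem _ v)
  have hdo : ∀ w, d w ∈ Sᗮ := fun w => (hSo _).2 (hX w)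
  have hmeas : Measurable fun v => Complex.exp ((inner ℝ v (d (X v)) : ℝ) * Complex.I) := by
    fun_prop
  have hm : Measurable fun p : V × V => S.starProjection p.1 + Sᗮ.starProjection p.2 := by fun_prop
  conv_lhs => rw [← map_starProjection_add_stdGaussian S]
  rw [integral_map hm.aemeasurable hmeas.aestronglyMeasurable]
  have heq : ∀ p : V × V, Complex.exp ((inner ℝ (S.starProjection p.1 + Sᗮ.starProjection p.2)
      (d (X (S.starProjection p.1 + Sᗮ.starProjection p.2))) : ℝ) * Complex.I) =
      Complex.exp ((inner ℝ p.2 (d (X p.1)) : ℝ) * Complex.I) := by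
    intro p
    rw [map_add, hXS, hXo, add_zero, inner_add_left,
      Submodule.inner_right_of_mem_orthogonal (Submodule.starProjection_apply_mem _ _) (hdo _),
      zero_add, Submodule.inner_starProjection_left_eq_right,
      Submodule.starProjection_eq_self_iff.2 (hdo _)]
  simp_rw [heq]
  have hmeas2 : Measurable fun p : V × V =>
      Complex.exp ((inner ℝ p.2 (d (X p.1)) : ℝ) * Complex.I) := by
    fun_prop
  rw [integral_prod]
  · simp_rw [← charFun_apply, charFun_stdGaussian]
    rw [integral_congr_ae (g := fun _ => Complex.exp (-r ^ 2 / 2))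
      (hr.mono fun v hv => by simp only [hv])]
    simp
  · refine Integrable.of_bound hmeas2.aestronglyMeasurable 1 (ae_of_all _ fun p => ?_)
    rw [Complex.norm_exp_ofReal_mul_I]

end Conditioning

/-! ### One row of the matrix. -/

section Row

variable {n : ℕ}

lemma map_pi_complexGaussian_zero_two (n : ℕ) :
    (Measure.pi fun _ : Fin n => complexGaussian 0 2).map (WithLp.toLp 2) =
      stdGaussian (EuclideanSpace ℂ (Fin n)) := by
  have : IsProbabilityMeasure ((Measure.pi fun _ : Fin n => complexGaussian 0 2).map
      (WithLp.toLp 2)) := Measure.isProbabilityMeasure_map (by fun_prop)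
  refine Measure.ext_of_charFun ?_
  ext t
  rw [charFun_pi, charFun_stdGaussian]
  simp_rw [charFun_complexGaussian_zero_two, ← Complex.exp_sum]
  congr 1
  have h : (‖t‖ : ℂ) ^ 2 = ∑ i, (‖t i‖ : ℂ) ^ 2 := by
    exact_mod_cast EuclideanSpace.norm_sq_eq t
  rw [h, ← Finset.sum_neg_distrib, Finset.sum_div]

/-- The embedding `ℝⁿ ⊆ ℂⁿ`. -/
noncomputable def ofRealVec (t : EuclideanSpace ℝ (Fin n)) : EuclideanSpace ℂ (Fin n) :=
  WithLp.toLp 2 fun j => (t j : ℂ)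

/-- The bilinear product `∑ j, v j * z j` of a complex vector `v` with a real vector `z`. -/
noncomputable def dotReal (z : EuclideanSpace ℝ (Fin n)) : EuclideanSpace ℂ (Fin n) →L[ℝ] ℂ :=
  LinearMap.toContinuousLinearMap
    { toFun := fun v => ∑ j, v j * (z j : ℂ)
      map_add' := fun v w => by simp [add_mul, Finset.sum_add_distrib]
      map_smul' := fun c v => by simp [Finset.mul_sum, mul_assoc] }

lemma dotReal_apply (z : EuclideanSpace ℝ (Fin n)) (v : EuclideanSpace ℂ (Fin n)) :
    dotReal z v = ∑ j, v j * (z j : ℂ) := rfl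

/-- Identifies the real adjoint of `dotReal t`, turning signed measurements into linear functionals
of the Gaussian row. -/
lemma inner_smul_ofRealVec (v : EuclideanSpace ℂ (Fin n)) (w : ℂ)
    (t : EuclideanSpace ℝ (Fin n)) :
    inner ℝ v (w • ofRealVec t) = inner ℝ (dotReal t v) w := by
  rw [PiLp.inner_apply, dotReal_apply, sum_inner]
  refine Finset.sum_congr rfl fun j _ => ?_
  simp only [ofRealVec, PiLp.smul_apply, smul_eq_mul, Complex.inner, map_mul, Complex.conj_ofReal]
  congr 1
  ring

lemma dotReal_smul_ofRealVec (z t : EuclideanSpace ℝ (Fin n)) (w : ℂ) :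
    dotReal z (w • ofRealVec t) = w * ((inner ℝ z t : ℝ) : ℂ) := by
  rw [PiLp.inner_apply, dotReal_apply, Complex.ofReal_sum, Finset.mul_sum]
  refine Finset.sum_congr rfl fun j _ => ?_
  simp [ofRealVec, mul_assoc]

lemma norm_ofRealVec (t : EuclideanSpace ℝ (Fin n)) : ‖ofRealVec t‖ = ‖t‖ := by
  simp [EuclideanSpace.norm_eq, ofRealVec]

lemma map_dotReal_stdGaussian {z : EuclideanSpace ℝ (Fin n)} (hz : ‖z‖ = 1) :
    (stdGaussian (EuclideanSpace ℂ (Fin n))).map (dotReal z) = stdGaussian ℂ := by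
  have hm : Measurable (dotReal z) := (dotReal z).continuous.measurable
  have : IsProbabilityMeasure ((stdGaussian (EuclideanSpace ℂ (Fin n))).map (dotReal z)) :=
    Measure.isProbabilityMeasure_map hm.aemeasurable
  refine Measure.ext_of_charFun ?_
  ext w
  rw [charFun_apply, integral_map hm.aemeasurable (by fun_prop)]
  simp_rw [← inner_smul_ofRealVec]
  rw [← charFun_apply, charFun_stdGaussian, charFun_stdGaussian, norm_smul, norm_ofRealVec, hz,
    mul_one]

/-- Nondegeneracy rules out atoms, so `⟨row, z⟩` is almost surely nonzero and its sign has modulus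
one. -/
lemma stdGaussian_complex_ne_dirac (x : ℂ) : stdGaussian ℂ ≠ Measure.dirac x := by
  intro h
  have h1 := integral_id_stdGaussian (E := ℂ)
  have h2 := integral_norm_stdGaussian_complex
  rw [h, integral_dirac] at h1 h2
  rw [h1, norm_zero, kappa] at h2
  have : 0 < √(Real.pi / 2) := by positivity
  linarith

lemma ae_dotReal_ne_zero {z : EuclideanSpace ℝ (Fin n)} (hz : ‖z‖ = 1) :
    ∀ᵐ v ∂(stdGaussian (EuclideanSpace ℂ (Fin n))), dotReal z v ≠ 0 := by
  have hm : Measurable (dotReal z) := (dotReal z).continuous.measurable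
  have := IsGaussian.nullSingletonClass stdGaussian_complex_ne_dirac
  have h0 : ∀ᵐ w ∂(stdGaussian ℂ), w ≠ 0 := Measure.ae_ne _ 0
  rw [← map_dotReal_stdGaussian hz] at h0
  exact ae_of_ae_map hm.aemeasurable h0

lemma measurable_signC : Measurable signC :=
  Measurable.ite (measurableSet_singleton 0) measurable_const (by fun_prop)

lemma norm_signC {w : ℂ} (hw : w ≠ 0) : ‖signC w‖ = 1 := by
  rw [signC, if_neg hw, norm_div, Complex.norm_real, norm_norm, div_self (norm_ne_zero_iff.2 hw)]

lemma conj_signC_mul_self (w : ℂ) : star (signC w) * w = ‖w‖ := by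
  by_cases hw : w = 0
  · simp [signC, hw]
  · have h : (‖w‖ : ℂ) ≠ 0 := by simpa using hw
    rw [signC, if_neg hw, star_div₀, div_mul_eq_mul_div, Complex.star_def,
      Complex.conj_ofReal, mul_comm, Complex.mul_conj, Complex.normSq_eq_norm_sq]
    push_cast
    field_simp

/-- The direction `ζ sign(w) t` lies in the kernel of `dotReal z` because `t ⟂ z`, and its norm is
almost surely `‖t‖`; hence the sign leaves the Gaussian law unchanged. -/
lemma integral_cexp_inner_dotReal {z t : EuclideanSpace ℝ (Fin n)} (hz : ‖z‖ = 1)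
    (hzt : inner ℝ z t = 0) {ζ : ℂ} (hζ : ‖ζ‖ = 1) :
    ∫ v, Complex.exp ((inner ℝ (dotReal t v) (ζ * signC (dotReal z v)) : ℝ) * Complex.I)
      ∂(stdGaussian (EuclideanSpace ℂ (Fin n))) = Complex.exp (-‖t‖ ^ 2 / 2) := by
  simp_rw [← inner_smul_ofRealVec]
  have hs := measurable_signC
  refine integral_cexp_inner_comp_stdGaussian (dotReal z)
    (d := fun w => (ζ * signC w) • ofRealVec t) (by fun_prop) (fun w => ?_) ?_
  · rw [dotReal_smul_ofRealVec, hzt, Complex.ofReal_zero, mul_zero]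
  · filter_upwards [ae_dotReal_ne_zero hz] with v hv
    rw [norm_smul, norm_mul, hζ, norm_signC hv, norm_ofRealVec, one_mul, one_mul]

end Row

/-! ### Decomposition of the correlation and its exact law. -/

section Matrix

variable {m n : ℕ}

instance isProbabilityMeasure_complexGaussianMatrix (m n : ℕ) (μ : ℂ) (v : ℝ≥0) :
    IsProbabilityMeasure (complexGaussianMatrix m n μ v) := by
  unfold complexGaussianMatrix
  infer_instance

lemma mulRealVec_of (Φ : Fin m → Fin n → ℂ) (u : EuclideanSpace ℝ (Fin n)) (i : Fin m) :
    mulRealVec (Matrix.of Φ) u i = dotReal u (WithLp.toLp 2 (Φ i)) := rfl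

/-- The vector `y ∈ ℝⁿ` with `⟨y, u⟩ = ∑ i, Re (conj (ζ sᵢ) (Φ u)ᵢ)`, where `s` is the sign of
`Φ z`. -/
noncomputable def signCorrelation (ζ : ℂ) (z : EuclideanSpace ℝ (Fin n))
    (Φ : Fin m → Fin n → ℂ) : EuclideanSpace ℝ (Fin n) :=
  WithLp.toLp 2 fun j => ∑ i, inner ℝ (Φ i j) (ζ * signC (mulRealVec (Matrix.of Φ) z i))

lemma measurable_mulRealVec_of (z : EuclideanSpace ℝ (Fin n)) (i : Fin m) :
    Measurable fun Φ : Fin m → Fin n → ℂ => mulRealVec (Matrix.of Φ) z i := by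
  simp_rw [mulRealVec_of]
  fun_prop

lemma measurable_signCorrelation (ζ : ℂ) (z : EuclideanSpace ℝ (Fin n)) :
    Measurable (signCorrelation ζ z : (Fin m → Fin n → ℂ) → EuclideanSpace ℝ (Fin n)) := by
  have hs := measurable_signC
  have hz := measurable_mulRealVec_of (m := m) z
  unfold signCorrelation
  fun_prop

lemma inner_signCorrelation (ζ : ℂ) (z t : EuclideanSpace ℝ (Fin n)) (Φ : Fin m → Fin n → ℂ) :
    inner ℝ (signCorrelation ζ z Φ) t =
      ∑ i, inner ℝ (mulRealVec (Matrix.of Φ) t i) (ζ * signC (mulRealVec (Matrix.of Φ) z i)) := by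
  simp only [PiLp.inner_apply, signCorrelation, mulRealVec_of Φ t, dotReal_apply, sum_inner]
  rw [Finset.sum_comm]
  refine Finset.sum_congr rfl fun j _ => ?_
  refine Finset.sum_congr rfl fun i _ => ?_
  simp [Complex.inner]
  ring

lemma mulRealVec_smul_add (Φ : Matrix (Fin m) (Fin n) ℂ) (a : ℝ)
    (u v : EuclideanSpace ℝ (Fin n)) (i : Fin m) :
    mulRealVec Φ (a • u + v) i = a * mulRealVec Φ u i + mulRealVec Φ v i := by
  simp only [mulRealVec, Matrix.mulVec, dotProduct, Finset.mul_sum, ← Finset.sum_add_distrib]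
  refine Finset.sum_congr rfl fun j _ => ?_
  simp
  ring

lemma star_mul_eq_inner_add (s x : ℂ) :
    star s * x = ((inner ℝ x (1 * s) : ℝ) : ℂ) + ((inner ℝ x (Complex.I * s) : ℝ) : ℂ) *
      Complex.I := by
  apply Complex.ext <;> simp [Complex.inner]
  ring

lemma cinner_sign_eq {z : EuclideanSpace ℝ (Fin n)} (hz : ‖z‖ = 1)
    (u : EuclideanSpace ℝ (Fin n)) (Φ : Fin m → Fin n → ℂ) :
    cinner (fun i => signC (mulRealVec (Matrix.of Φ) z i)) (mulRealVec (Matrix.of Φ) u) =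
      ((inner ℝ z u * ∑ i, ‖mulRealVec (Matrix.of Φ) z i‖ : ℝ) : ℂ) +
      ((inner ℝ ((ℝ ∙ z)ᗮ.starProjection (signCorrelation 1 z Φ)) u : ℝ) : ℂ) +
      ((inner ℝ ((ℝ ∙ z)ᗮ.starProjection (signCorrelation Complex.I z Φ)) u : ℝ) : ℂ) *
        Complex.I := by
  have hu : u = (inner ℝ z u : ℝ) • z + (ℝ ∙ z)ᗮ.starProjection u := by
    conv_lhs => rw [← (ℝ ∙ z).starProjection_add_starProjection_orthogonal u]
    rw [Submodule.starProjection_unit_singleton ℝ hz]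
  simp only [Submodule.inner_starProjection_left_eq_right, inner_signCorrelation]
  set p := (ℝ ∙ z)ᗮ.starProjection u
  have h1 : ∀ i, mulRealVec (Matrix.of Φ) u i =
      ((inner ℝ z u : ℝ) : ℂ) * mulRealVec (Matrix.of Φ) z i + mulRealVec (Matrix.of Φ) p i := by
    intro i
    conv_lhs => rw [hu]
    exact mulRealVec_smul_add _ _ _ _ _
  simp only [cinner, dotProduct, h1, Complex.ofReal_sum, Complex.ofReal_mul, Finset.mul_sum,
    Finset.sum_mul, ← Finset.sum_add_distrib]
  refine Finset.sum_congr rfl fun i _ => ?_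
  rw [Pi.star_apply, mul_add, star_mul_eq_inner_add _ (mulRealVec (Matrix.of Φ) p i),
    ← conj_signC_mul_self]
  ring

/-- Rows are independent, so the characteristic function is the `m`-th power of the one-row value
`exp (-‖p‖² / 2)`, with `p` the projection of `t`. -/
lemma map_starProjection_signCorrelation {z : EuclideanSpace ℝ (Fin n)} (hz : ‖z‖ = 1) {ζ : ℂ}
    (hζ : ‖ζ‖ = 1) :
    (complexGaussianMatrix m n 0 2).map
      (fun Φ => (ℝ ∙ z)ᗮ.starProjection (signCorrelation ζ z Φ)) =
    (stdGaussian (EuclideanSpace ℝ (Fin n))).map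
      (fun x => √m • (ℝ ∙ z)ᗮ.starProjection x) := by
  have hY := measurable_signCorrelation (m := m) ζ z
  have hs := measurable_signC
  have hm1 : Measurable fun Φ : Fin m → Fin n → ℂ =>
      (ℝ ∙ z)ᗮ.starProjection (signCorrelation ζ z Φ) := by fun_prop
  have hm2 : Measurable fun x : EuclideanSpace ℝ (Fin n) =>
      √m • (ℝ ∙ z)ᗮ.starProjection x := by fun_prop
  have := Measure.isProbabilityMeasure_map (μ := complexGaussianMatrix m n 0 2) hm1.aemeasurable
  have := Measure.isProbabilityMeasure_map
    (μ := stdGaussian (EuclideanSpace ℝ (Fin n))) hm2.aemeasurable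
  refine Measure.ext_of_charFun ?_
  ext t
  rw [charFun_apply, charFun_apply, integral_map hm1.aemeasurable (by fun_prop),
    integral_map hm2.aemeasurable (by fun_prop)]
  simp_rw [real_inner_smul_left, Submodule.inner_starProjection_left_eq_right,
    ← real_inner_smul_right]
  rw [← charFun_apply, charFun_stdGaussian]
  set p := (ℝ ∙ z)ᗮ.starProjection t with hp
  have hzp : inner ℝ z p = 0 :=
    Submodule.mem_orthogonal_singleton_iff_inner_right.1 (Submodule.starProjection_apply_mem _ t)
  simp_rw [inner_signCorrelation, mulRealVec_of, Complex.ofReal_sum, Finset.sum_mul,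
    Complex.exp_sum]
  have hg : Measurable fun v : EuclideanSpace ℂ (Fin n) =>
      Complex.exp ((inner ℝ (dotReal p v) (ζ * signC (dotReal z v)) : ℝ) * Complex.I) := by
    fun_prop
  rw [complexGaussianMatrix, integral_fintype_prod_eq_prod (fun (_ : Fin m) (φ : Fin n → ℂ) =>
    Complex.exp ((inner ℝ (dotReal p (WithLp.toLp 2 φ))
      (ζ * signC (dotReal z (WithLp.toLp 2 φ))) : ℝ) * Complex.I))]
  have hrow := integral_cexp_inner_dotReal hz hzp hζ
  rw [← map_pi_complexGaussian_zero_two, integral_map (by fun_prop) hg.aestronglyMeasurable] at hrow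
  simp_rw [hrow]
  rw [Finset.prod_const, Finset.card_univ, Fintype.card_fin, ← Complex.exp_nat_mul, norm_smul]
  congr 1
  have h2 : ((‖√(m : ℝ)‖ * ‖p‖ : ℝ) : ℂ) ^ 2 = m * (‖p‖ : ℂ) ^ 2 := by
    rw [Real.norm_of_nonneg (Real.sqrt_nonneg _)]
    have : (√(m : ℝ) * ‖p‖) ^ 2 = m * ‖p‖ ^ 2 := by
      rw [mul_pow, Real.sq_sqrt (Nat.cast_nonneg m)]
    exact_mod_cast this
  rw [h2]
  ring

end Matrix

/-! ### Tail bounds for the two parts. -/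

section Tails

variable {m n : ℕ}

lemma supInner_closedBall {E : Type*} [NormedAddCommGroup E] [InnerProductSpace ℝ E] (x : E) :
    supInner (fun u : Metric.closedBall (0 : E) 1 => (u : E)) x = ‖x‖ := by
  have hf : ∀ u : Metric.closedBall (0 : E) 1, ‖(u : E)‖ ≤ 1 := fun u =>
    mem_closedBall_zero_iff.1 u.2
  have : Nonempty (Metric.closedBall (0 : E) 1) := ⟨⟨0, by simp⟩⟩
  refine le_antisymm (supInner_le_norm hf x) ?_
  by_cases hx : x = 0
  · have h := inner_le_supInner hf x ⟨0, by simp⟩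
    simpa [hx] using h
  · have hx' : ‖x‖ ≠ 0 := norm_ne_zero_iff.2 hx
    have h := inner_le_supInner hf x ⟨‖x‖⁻¹ • x, by simp [norm_smul, hx']⟩
    rw [real_inner_smul_right, real_inner_self_eq_norm_sq, sq, inv_mul_cancel_left₀ hx'] at h
    exact h

lemma hasSubgaussianMGF_norm_stdGaussian_complex :
    HasSubgaussianMGF (fun x : ℂ => ‖x‖ - kappa) (Real.pi ^ 2 / 4).toNNReal (stdGaussian ℂ) := by
  have : Nonempty (Metric.closedBall (0 : ℂ) 1) := ⟨⟨0, by simp⟩⟩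
  have h := hasSubgaussianMGF_supInner (E := ℂ)
    (f := fun u : Metric.closedBall (0 : ℂ) 1 => (u : ℂ)) fun u =>
    mem_closedBall_zero_iff.1 u.2
  simpa only [supInner_closedBall, integral_norm_stdGaussian_complex] using h

lemma hasSubgaussianMGF_sum_norm_mulRealVec {z : EuclideanSpace ℝ (Fin n)} (hz : ‖z‖ = 1) :
    HasSubgaussianMGF
      (fun Φ : Fin m → Fin n → ℂ => ∑ i, (‖mulRealVec (Matrix.of Φ) z i‖ - kappa))
      (m * (Real.pi ^ 2 / 4).toNNReal) (complexGaussianMatrix m n 0 2) := by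
  have hrow : Measurable fun φ : Fin n → ℂ => dotReal z (WithLp.toLp 2 φ) := by fun_prop
  have hlaw : (Measure.pi fun _ : Fin n => complexGaussian 0 2).map
      (fun φ => dotReal z (WithLp.toLp 2 φ)) = stdGaussian ℂ := by
    rw [← map_dotReal_stdGaussian hz, ← map_pi_complexGaussian_zero_two,
      Measure.map_map (by fun_prop) (by fun_prop)]
    rfl
  have hindep : iIndepFun (fun (i : Fin m) (Φ : Fin m → Fin n → ℂ) =>
      ‖mulRealVec (Matrix.of Φ) z i‖ - kappa) (complexGaussianMatrix m n 0 2) :=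
    iIndepFun_pi (X := fun (_ : Fin m) (φ : Fin n → ℂ) =>
      ‖dotReal z (WithLp.toLp 2 φ)‖ - kappa) fun _ => by fun_prop
  have hsub : ∀ i ∈ Finset.univ, HasSubgaussianMGF (fun Φ : Fin m → Fin n → ℂ =>
      ‖mulRealVec (Matrix.of Φ) z i‖ - kappa) (Real.pi ^ 2 / 4).toNNReal
      (complexGaussianMatrix m n 0 2) := by
    intro i _
    refine HasSubgaussianMGF.of_map (X := fun x : ℂ => ‖x‖ - kappa)
      (Y := fun Φ : Fin m → Fin n → ℂ => mulRealVec (Matrix.of Φ) z i)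
      (measurable_mulRealVec_of z i).aemeasurable ?_
    have : (complexGaussianMatrix m n 0 2).map (fun Φ => mulRealVec (Matrix.of Φ) z i) =
        stdGaussian ℂ := by
      rw [← hlaw, ← (measurePreserving_eval
        (fun _ : Fin m => Measure.pi fun _ : Fin n => complexGaussian 0 2) i).map_eq,
        Measure.map_map hrow (measurable_pi_apply i)]
      rfl
    rw [this]
    exact hasSubgaussianMGF_norm_stdGaussian_complex
  simpa using HasSubgaussianMGF.sum_of_iIndepFun hindep hsub

lemma measureReal_le_abs_sum_norm_mulRealVec_sub_le {z : EuclideanSpace ℝ (Fin n)} (hz : ‖z‖ = 1)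
    {ε : ℝ} (hε : 0 ≤ ε) :
    (complexGaussianMatrix m n 0 2).real
      {Φ | ε ≤ |∑ i, ‖mulRealVec (Matrix.of Φ) z i‖ - kappa * m|} ≤
      2 * Real.exp (-ε ^ 2 / (2 * (m * (Real.pi ^ 2 / 4)))) := by
  have h := hasSubgaussianMGF_sum_norm_mulRealVec (m := m) hz
  have h1 := h.measure_ge_le hε
  have h2 := h.neg.measure_ge_le hε
  rw [NNReal.coe_mul, NNReal.coe_natCast, Real.coe_toNNReal _ (by positivity)] at h1 h2
  rw [two_mul]
  refine (measureReal_mono ?_).trans ((measureReal_union_le _ _).trans (add_le_add h1 h2))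
  intro Φ hΦ
  have hs : ∑ i, (‖mulRealVec (Matrix.of Φ) z i‖ - kappa) =
      ∑ i, ‖mulRealVec (Matrix.of Φ) z i‖ - kappa * m := by
    simp [Finset.sum_sub_distrib, mul_comm]
  simp only [Set.mem_union, Set.mem_ofPred_eq, Pi.neg_apply, hs]
  exact le_abs.1 hΦ

/-- From `|t| ≤ exp t + exp (-t)` the mean is at most `2 exp (1/2) ≤ 4`; sharpness is irrelevant. -/
lemma integral_abs_inner_stdGaussian_le {E : Type*} [NormedAddCommGroup E]
    [InnerProductSpace ℝ E] [FiniteDimensional ℝ E] [MeasurableSpace E] [BorelSpace E] {z : E}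
    (hz : ‖z‖ = 1) : ∫ x, |inner ℝ x z| ∂(stdGaussian E) ≤ 4 := by
  have h1 := (integrable_exp_inner_stdGaussian z).add (integrable_exp_inner_stdGaussian (-z))
  have h2 : ∫ x, (Real.exp (inner ℝ x z) + Real.exp (inner ℝ x (-z))) ∂(stdGaussian E) ≤ 4 := by
    rw [integral_add (integrable_exp_inner_stdGaussian z) (integrable_exp_inner_stdGaussian (-z)),
      integral_exp_inner_stdGaussian, integral_exp_inner_stdGaussian, norm_neg, hz]
    have h3 : Real.exp (1 / 2) * Real.exp (1 / 2) = Real.exp 1 := by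
      rw [← Real.exp_add]; norm_num
    have h4 := Real.exp_one_lt_d9
    have h5 : Real.exp (1 / 2) ≤ 2 := by nlinarith [Real.exp_pos (1 / 2)]
    norm_num at h5 ⊢
    linarith
  refine le_trans (integral_mono_of_nonneg (ae_of_all _ fun x => abs_nonneg _) h1
    (ae_of_all _ fun x => ?_)) h2
  have h3 := Real.add_one_le_exp (inner ℝ x z)
  have h4 := Real.add_one_le_exp (inner ℝ x (-z))
  have h5 := Real.exp_pos (inner ℝ x z)
  have h6 := Real.exp_pos (inner ℝ x (-z))
  rw [inner_neg_right] at h4 h6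
  simp only [Pi.add_apply, inner_neg_right]
  exact abs_le'.2 ⟨by linarith, by linarith⟩

/-- Removing the `z` component of `f i` changes `⟨x, f i⟩` by at most `|⟨x, z⟩|`, uniformly in `i`.
-/
lemma integral_supInner_starProjection_le {E ι : Type*} [NormedAddCommGroup E]
    [InnerProductSpace ℝ E] [FiniteDimensional ℝ E] [MeasurableSpace E] [BorelSpace E]
    [Nonempty ι] {f : ι → E} (hf : ∀ i, ‖f i‖ ≤ 1) {z : E} (hz : ‖z‖ = 1) :
    ∫ x, supInner (fun i => (ℝ ∙ z)ᗮ.starProjection (f i)) x ∂(stdGaussian E) ≤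
      ∫ x, supInner f x ∂(stdGaussian E) + 4 := by
  have hPf : ∀ i, ‖(ℝ ∙ z)ᗮ.starProjection (f i)‖ ≤ 1 := fun i =>
    (Submodule.norm_starProjection_apply_le _ _).trans (hf i)
  have hi : Integrable (fun x => |inner ℝ x z|) (stdGaussian E) :=
    (IsGaussian.integrable_id (μ := stdGaussian E)).norm.mono' (by fun_prop)
      (ae_of_all _ fun x => by
        have := abs_real_inner_le_norm x z
        rw [hz, mul_one] at this
        simpa using this)
  have hF := integrable_supInner_stdGaussian hf
  refine le_trans ?_ (add_le_add_right (integral_abs_inner_stdGaussian_le hz) _)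
  rw [← integral_add hF hi]
  refine integral_mono (integrable_supInner_stdGaussian hPf) (hF.add hi) fun x => ?_
  refine ciSup_le fun i => ?_
  have h1 := inner_le_supInner hf x i
  have h2 : (ℝ ∙ z)ᗮ.starProjection (f i) = f i - (inner ℝ z (f i) : ℝ) • z := by
    rw [← Submodule.starProjection_unit_singleton ℝ hz, eq_sub_iff_add_eq',
      Submodule.starProjection_add_starProjection_orthogonal]
  simp only [h2]
  rw [inner_sub_right, real_inner_smul_right]
  have h3 : |inner ℝ z (f i) * inner ℝ x z| ≤ |inner ℝ x z| := by
    rw [abs_mul]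
    refine mul_le_of_le_one_left (abs_nonneg _) ((abs_real_inner_le_norm z (f i)).trans ?_)
    rw [hz, one_mul]
    exact hf i
  have h4 := neg_abs_le (inner ℝ z (f i) * inner ℝ x z)
  linarith

lemma measureReal_le_supInner_signCorrelation_le {ι : Type*} [Nonempty ι]
    {f : ι → EuclideanSpace ℝ (Fin n)} (hf : ∀ i, ‖f i‖ ≤ 1) {z : EuclideanSpace ℝ (Fin n)}
    (hz : ‖z‖ = 1) {ζ : ℂ} (hζ : ‖ζ‖ = 1) (hm : 0 < m) {s : ℝ} (hs : 0 ≤ s) :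
    (complexGaussianMatrix m n 0 2).real
      {Φ | √m * (∫ x, supInner f x ∂(stdGaussian (EuclideanSpace ℝ (Fin n))) + 4 + s) ≤
        supInner f ((ℝ ∙ z)ᗮ.starProjection (signCorrelation ζ z Φ))} ≤
      Real.exp (-s ^ 2 / (2 * (Real.pi ^ 2 / 4))) := by
  have hPf : ∀ i, ‖(ℝ ∙ z)ᗮ.starProjection (f i)‖ ≤ 1 := fun i =>
    (Submodule.norm_starProjection_apply_le _ _).trans (hf i)
  have hY := measurable_signCorrelation (m := m) ζ z
  have hF := (continuous_supInner hf).measurable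
  set M := ∫ x, supInner f x ∂(stdGaussian (EuclideanSpace ℝ (Fin n)))
  have hmean := integral_supInner_starProjection_le hf hz
  have htail := (hasSubgaussianMGF_supInner hPf).measure_ge_le hs
  rw [Real.coe_toNNReal _ (by positivity)] at htail
  have hset : MeasurableSet {y | √m * (M + 4 + s) ≤ supInner f y} :=
    measurableSet_le (by fun_prop) hF
  have hlaw := map_starProjection_signCorrelation (m := m) hz hζ
  have h1 := map_measureReal_apply (μ := complexGaussianMatrix m n 0 2)
    (f := fun Φ => (ℝ ∙ z)ᗮ.starProjection (signCorrelation ζ z Φ)) (by fun_prop) hset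
  rw [hlaw, map_measureReal_apply (by fun_prop) hset] at h1
  refine h1.symm.le.trans (le_trans (measureReal_mono ?_) htail)
  intro x hx
  have hsm : 0 < √(m : ℝ) := by positivity
  have h2 : supInner f ((ℝ ∙ z)ᗮ.starProjection x) =
      supInner (fun i => (ℝ ∙ z)ᗮ.starProjection (f i)) x := by
    simp only [supInner, Submodule.inner_starProjection_left_eq_right]
  simp only [Set.mem_preimage, Set.mem_ofPred_eq, supInner_smul hsm.le, h2] at hx ⊢
  have h3 := le_of_mul_le_mul_left hx hsm
  linarith

end Tails

/-! ### From the sphere to the cone: the deterministic estimate. -/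

section SymmetricCone

variable {m n : ℕ}

lemma one_le_kappa : 1 ≤ kappa := by
  rw [kappa, Real.one_le_sqrt]
  linarith [Real.two_le_pi]

/-- Scaling invariance reduces to unit vectors; symmetry supplies the absolute value. -/
lemma abs_inner_le_norm_mul_supInner {K : Set (EuclideanSpace ℝ (Fin n))}
    (hK : IsSymmetricCone K) (y : EuclideanSpace ℝ (Fin n)) {u : EuclideanSpace ℝ (Fin n)}
    (hu : u ∈ K) :
    |inner ℝ y u| ≤ ‖u‖ * supInner
      (fun v : (K ∩ Metric.sphere 0 1 : Set _) => (v : EuclideanSpace ℝ (Fin n))) y := by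
  by_cases h0 : u = 0
  · simp [h0]
  have hpos : 0 < ‖u‖ := norm_pos_iff.2 h0
  have hf : ∀ v : (K ∩ Metric.sphere 0 1 : Set (EuclideanSpace ℝ (Fin n))),
      ‖(v : EuclideanSpace ℝ (Fin n))‖ ≤ 1 := fun v => (mem_sphere_zero_iff_norm.1 v.2.2).le
  have hv : ‖u‖⁻¹ • u ∈ K := hK.2 _ (inv_pos.2 hpos) (Set.smul_mem_smul_set hu)
  have hvn : -(‖u‖⁻¹ • u) ∈ K := by
    rw [← hK.1]
    simpa using hv
  have hn : ‖‖u‖⁻¹ • u‖ = 1 := by simp [norm_smul, hpos.ne']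
  have h1 := inner_le_supInner hf y ⟨‖u‖⁻¹ • u, hv, by simpa using hn⟩
  have h2 := inner_le_supInner hf y ⟨-(‖u‖⁻¹ • u), hvn, by simpa using hn⟩
  simp only [inner_neg_right, real_inner_smul_right] at h1 h2
  rw [← div_le_iff₀' hpos, div_eq_inv_mul, ← abs_of_pos (inv_pos.2 hpos), ← abs_mul]
  exact abs_le'.2 ⟨h1, h2⟩

/-- The error budget is `δ/2` along `z` and `δ/4` for each of the real and imaginary parts across
it. -/
lemma norm_cinner_sub_le {K : Set (EuclideanSpace ℝ (Fin n))} (hK : IsSymmetricCone K) {δ : ℝ}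
    {z : EuclideanSpace ℝ (Fin n)} (hz : ‖z‖ = 1) (hm : 0 < m) (Φ : Fin m → Fin n → ℂ)
    (hS : |∑ i, ‖mulRealVec (Matrix.of Φ) z i‖ - kappa * m| ≤ kappa * m * δ / 2)
    (hY : ∀ ζ ∈ ({1, Complex.I} : Set ℂ), supInner
      (fun v : (K ∩ Metric.sphere 0 1 : Set _) => (v : EuclideanSpace ℝ (Fin n)))
      ((ℝ ∙ z)ᗮ.starProjection (signCorrelation ζ z Φ)) ≤ kappa * m * δ / 4)
    {u : EuclideanSpace ℝ (Fin n)} (hu : u ∈ K) :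
    ‖((kappa * m : ℝ) : ℂ)⁻¹ *
      cinner (fun i => signC (mulRealVec (Matrix.of Φ) z i)) (mulRealVec (Matrix.of Φ) u)
      - ((inner ℝ z u : ℝ) : ℂ)‖ ≤ δ * ‖u‖ := by
  have hm0 : (0 : ℝ) < m := by exact_mod_cast hm
  have hk : 0 < kappa * m := mul_pos (zero_lt_one.trans_le one_le_kappa) hm0
  rw [cinner_sign_eq hz]
  have hy : ∀ ζ ∈ ({1, Complex.I} : Set ℂ),
      |inner ℝ ((ℝ ∙ z)ᗮ.starProjection (signCorrelation ζ z Φ)) u| ≤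
        ‖u‖ * (kappa * m * δ / 4) := fun ζ hζ =>
    (abs_inner_le_norm_mul_supInner hK _ hu).trans
      (mul_le_mul_of_nonneg_left (hY ζ hζ) (norm_nonneg u))
  have hy1 := hy 1 (by simp)
  have hy2 := hy Complex.I (by simp)
  set y1 := inner ℝ ((ℝ ∙ z)ᗮ.starProjection (signCorrelation 1 z Φ)) u
  set y2 := inner ℝ ((ℝ ∙ z)ᗮ.starProjection (signCorrelation Complex.I z Φ)) u
  set S := ∑ i, ‖mulRealVec (Matrix.of Φ) z i‖
  set k := kappa * m
  have hzu : |inner ℝ z u| ≤ ‖u‖ := by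
    have := abs_real_inner_le_norm z u
    rwa [hz, one_mul] at this
  have hkC : (k : ℂ) ≠ 0 := by exact_mod_cast hk.ne'
  have heq : (k : ℂ)⁻¹ * (((inner ℝ z u * S : ℝ) : ℂ) + (y1 : ℂ) + (y2 : ℂ) * Complex.I) -
      ((inner ℝ z u : ℝ) : ℂ) =
      (k : ℂ)⁻¹ * (((inner ℝ z u * (S - k) : ℝ) : ℂ) + (y1 : ℂ) + (y2 : ℂ) * Complex.I) := by
    push_cast
    field_simp
    ring
  rw [heq, norm_mul, norm_inv, Complex.norm_real, Real.norm_of_nonneg hk.le, inv_mul_le_iff₀ hk]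
  have h1 : |inner ℝ z u * (S - k)| ≤ ‖u‖ * (k * δ / 2) := by
    rw [abs_mul]
    exact mul_le_mul hzu hS (abs_nonneg _) (norm_nonneg u)
  refine (norm_add₃_le).trans ?_
  rw [norm_mul, Complex.norm_I, mul_one, Complex.norm_real, Complex.norm_real, Complex.norm_real,
    Real.norm_eq_abs, Real.norm_eq_abs, Real.norm_eq_abs]
  linarith

end SymmetricCone

/-! ### Choice of constants and union bound. -/

section MainTheorem

variable {m n : ℕ}

/-- For small `δ² m` the claim is vacuous: the exponent stays above `-5` and `exp 5 < 256`. -/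
lemma one_sub_mul_exp_lt_of_lt {P q : ℝ} (hP : 0 ≤ P) (hq : q < 4096) :
    1 - 256 * Real.exp (-(1 / 1000) * q) < P := by
  have h1 : Real.exp 5 * Real.exp (-5) = 1 := by rw [← Real.exp_add]; norm_num
  have h2 : Real.exp 5 < 256 := by
    have h := pow_lt_pow_left₀ Real.exp_one_lt_d9 (Real.exp_pos 1).le (n := 5) (by norm_num)
    rw [← Real.exp_nat_mul] at h
    norm_num at h
    linarith
  have h3 : Real.exp (-5) ≤ Real.exp (-(1 / 1000) * q) := Real.exp_le_exp.2 (by linarith)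
  nlinarith [Real.exp_pos (-5)]

lemma measureReal_abs_sum_norm_tail {z : EuclideanSpace ℝ (Fin n)} (hz : ‖z‖ = 1) {δ : ℝ}
    (hδ : 0 < δ) (hm : 0 < m) :
    (complexGaussianMatrix m n 0 2).real
      {Φ | kappa * m * δ / 2 ≤ |∑ i, ‖mulRealVec (Matrix.of Φ) z i‖ - kappa * m|} ≤
      2 * Real.exp (-(1 / 1000) * (δ ^ 2 * m)) := by
  have hm0 : (0 : ℝ) < m := by exact_mod_cast hm
  have hk : 1 ≤ kappa ^ 2 := one_le_pow₀ one_le_kappa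
  have hkp : 0 < kappa := zero_lt_one.trans_le one_le_kappa
  refine (measureReal_le_abs_sum_norm_mulRealVec_sub_le hz (by positivity)).trans ?_
  refine mul_le_mul_of_nonneg_left (Real.exp_le_exp.2 ?_) zero_le_two
  have hpi : Real.pi ^ 2 ≤ 16 := by nlinarith [Real.pi_le_four, Real.pi_pos]
  rw [div_le_iff₀ (by positivity)]
  have h1 : (m : ℝ) * (δ ^ 2 * m) * Real.pi ^ 2 ≤ (m : ℝ) * (δ ^ 2 * m) * 16 :=
    mul_le_mul_of_nonneg_left hpi (by positivity)
  have h2 : (m : ℝ) * (δ ^ 2 * m) * 1 ≤ (m : ℝ) * (δ ^ 2 * m) * kappa ^ 2 :=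
    mul_le_mul_of_nonneg_left hk (by positivity)
  nlinarith

lemma measureReal_supInner_tail {T : Set (EuclideanSpace ℝ (Fin n))} (hne : T.Nonempty)
    (hT : ∀ u ∈ T, ‖u‖ ≤ 1) {z : EuclideanSpace ℝ (Fin n)} (hz : ‖z‖ = 1) {ζ : ℂ} (hζ : ‖ζ‖ = 1)
    {δ : ℝ} (hδ : 0 < δ) (hm : 0 < m) (hw : 256 * gaussianMeanWidth T ^ 2 ≤ δ ^ 2 * m)
    (hq : 4096 ≤ δ ^ 2 * m) :
    (complexGaussianMatrix m n 0 2).real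
      {Φ | kappa * m * δ / 4 ≤ supInner (fun v : T => (v : EuclideanSpace ℝ (Fin n)))
        ((ℝ ∙ z)ᗮ.starProjection (signCorrelation ζ z Φ))} ≤
      Real.exp (-(1 / 1000) * (δ ^ 2 * m)) := by
  have : Nonempty T := hne.to_subtype
  have hm0 : (0 : ℝ) < m := by exact_mod_cast hm
  have hsq : √(m : ℝ) ^ 2 = m := Real.sq_sqrt hm0.le
  have hr : 0 < δ * √m := by positivity
  have hr2 : (δ * √m) ^ 2 = δ ^ 2 * m := by rw [mul_pow, hsq]
  have h64 : 64 ≤ δ * √m := by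
    refine le_of_sq_le_sq ?_ hr.le
    rw [hr2]
    linarith
  have hw' : 16 * gaussianMeanWidth T ≤ δ * √m := by
    refine le_of_sq_le_sq ?_ hr.le
    rw [hr2, mul_pow]
    linarith
  have hs : 0 ≤ δ * √m / 8 := by positivity
  have h := measureReal_le_supInner_signCorrelation_le (m := m)
    (f := fun v : T => (v : EuclideanSpace ℝ (Fin n))) (fun v => hT v v.2) hz hζ hm hs
  refine (measureReal_mono fun Φ hΦ => ?_).trans (h.trans (Real.exp_le_exp.2 ?_))
  · simp only [Set.mem_ofPred_eq] at hΦ ⊢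
    refine le_trans ?_ hΦ
    have hM : ∫ x, supInner (fun v : T => (v : EuclideanSpace ℝ (Fin n))) x
        ∂(stdGaussian (EuclideanSpace ℝ (Fin n))) = gaussianMeanWidth T := rfl
    rw [hM]
    -- The width and the constant `4` each cost at most `δ √m / 16`, by `256 w² ≤ δ² m` and `4096 ≤
    -- δ² m`; the deviation takes the remaining `δ √m / 8`.
    have h1 : √(m : ℝ) * (gaussianMeanWidth T + 4 + δ * √m / 8) ≤ √m * (δ * √m / 4) :=
      mul_le_mul_of_nonneg_left (by linarith) (Real.sqrt_nonneg _)
    have h2 : √(m : ℝ) * (δ * √m / 4) = m * δ / 4 := by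
      calc √(m : ℝ) * (δ * √m / 4) = √(m : ℝ) ^ 2 * δ / 4 := by ring
        _ = m * δ / 4 := by rw [hsq]
    have h3 : 1 * (m * δ / 4) ≤ kappa * (m * δ / 4) :=
      mul_le_mul_of_nonneg_right one_le_kappa (by positivity)
    linarith
  · have hpi : Real.pi ^ 2 ≤ 16 := by nlinarith [Real.pi_le_four, Real.pi_pos]
    rw [div_le_iff₀ (by positivity), div_pow, hr2]
    have : δ ^ 2 * m * Real.pi ^ 2 ≤ δ ^ 2 * m * 16 :=
      mul_le_mul_of_nonneg_left hpi (by positivity)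
    linarith

end MainTheorem

theorem lemma4 :
    ∃ C c : ℝ, 0 < C ∧ 0 < c ∧
      ∀ (m n : ℕ) (K : Set (EuclideanSpace ℝ (Fin n))) (δ : ℝ) (z : EuclideanSpace ℝ (Fin n)),
        0 < m → IsSymmetricCone K → 0 < δ → ‖z‖ = 1 →
        C * (δ ^ 2)⁻¹ * gaussianMeanWidth (K ∩ Metric.sphere 0 1) ^ 2 ≤ (m : ℝ) →
        1 - C * Real.exp (-c * δ ^ 2 * m) <
          (complexGaussianMatrix m n 0 2).real
            {Φ | ∀ u ∈ K,
              ‖((kappa * m : ℝ) : ℂ)⁻¹ *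
                  cinner (fun i => signC (mulRealVec (Matrix.of Φ) z i)) (mulRealVec (Matrix.of Φ) u)
                - ((inner ℝ z u : ℝ) : ℂ)‖ ≤ δ * ‖u‖} := by
  refine ⟨256, 1 / 1000, by norm_num, by norm_num, fun m n K δ z hm hK hδ hz hw => ?_⟩
  rw [mul_assoc (-(1 / 1000 : ℝ))]
  rcases lt_or_ge (δ ^ 2 * m) 4096 with hq | hq
  · exact one_sub_mul_exp_lt_of_lt measureReal_nonneg hq
  have hδ2 : 0 < δ ^ 2 := by positivity
  have hw' : 256 * gaussianMeanWidth (K ∩ Metric.sphere 0 1) ^ 2 ≤ δ ^ 2 * m := by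
    rw [mul_assoc, mul_left_comm, inv_mul_le_iff₀ hδ2] at hw
    exact hw
  have he := Real.exp_pos (-(1 / 1000) * (δ ^ 2 * m))
  set T : Set (EuclideanSpace ℝ (Fin n)) := K ∩ Metric.sphere 0 1 with hT
  set μ := complexGaussianMatrix m n 0 2
  set good := {Φ : Fin m → Fin n → ℂ | ∀ u ∈ K,
    ‖((kappa * m : ℝ) : ℂ)⁻¹ *
      cinner (fun i => signC (mulRealVec (Matrix.of Φ) z i)) (mulRealVec (Matrix.of Φ) u)
      - ((inner ℝ z u : ℝ) : ℂ)‖ ≤ δ * ‖u‖} with hgood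
  set A := {Φ : Fin m → Fin n → ℂ |
    kappa * m * δ / 2 ≤ |∑ i, ‖mulRealVec (Matrix.of Φ) z i‖ - kappa * m|} with hA
  set B : ℂ → Set (Fin m → Fin n → ℂ) := fun ζ => {Φ | kappa * m * δ / 4 ≤
    supInner (fun v : T => (v : EuclideanSpace ℝ (Fin n)))
      ((ℝ ∙ z)ᗮ.starProjection (signCorrelation ζ z Φ))} with hB
  have hPA : μ.real A ≤ 2 * Real.exp (-(1 / 1000) * (δ ^ 2 * m)) :=
    measureReal_abs_sum_norm_tail hz hδ hm
  rcases T.eq_empty_or_nonempty with hne | hne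
  -- An empty spherical part forces `K ⊆ {0}`; the tail bounds require a nonempty index set.
  · have huniv : good = Set.univ := by
      refine Set.eq_univ_of_forall fun Φ u hu => ?_
      have h0 : u = 0 := by
        by_contra h0
        have hmem : ‖u‖⁻¹ • u ∈ T :=
          ⟨hK.2 _ (inv_pos.2 (norm_pos_iff.2 h0)) (Set.smul_mem_smul_set hu), by
            simp [norm_smul, h0]⟩
        rw [hne] at hmem
        exact hmem
      subst h0
      simp [mulRealVec, cinner, ← Pi.zero_def]
    rw [huniv, probReal_univ]
    linarith
  have hPB : ∀ ζ : ℂ, ‖ζ‖ = 1 → μ.real (B ζ) ≤ Real.exp (-(1 / 1000) * (δ ^ 2 * m)) :=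
    fun ζ hζ => measureReal_supInner_tail hne
      (fun u hu => (mem_sphere_zero_iff_norm.1 hu.2).le) hz hζ hδ hm hw' hq
  -- Covering the whole space, rather than taking a complement, avoids any measurability claim about
  -- `good`. The bad events cost `2 + 1 + 1 = 4` exponentials, below the allowed `256`.
  have hcover : (Set.univ : Set (Fin m → Fin n → ℂ)) ⊆ good ∪ (A ∪ (B 1 ∪ B Complex.I)) := by
    intro Φ _
    by_contra hΦ
    simp only [Set.mem_union, not_or] at hΦ
    obtain ⟨hg, ha, hb1, hb2⟩ := hΦ
    refine hg fun u hu => norm_cinner_sub_le hK hz hm Φ (le_of_not_ge ha) ?_ hu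
    rintro ζ (rfl | rfl)
    · exact le_of_not_ge hb1
    · exact le_of_not_ge hb2
  have h1 := measureReal_mono (μ := μ) hcover
  rw [probReal_univ] at h1
  have h2 := measureReal_union_le (μ := μ) good (A ∪ (B 1 ∪ B Complex.I))
  have h3 := measureReal_union_le (μ := μ) A (B 1 ∪ B Complex.I)
  have h4 := measureReal_union_le (μ := μ) (B 1) (B Complex.I)
  have h5 := hPB 1 (by simp)
  have h6 := hPB Complex.I (by simp)
  linarith
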